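/- Let $\Omega\subset\mathbb R^d$ be a bounded open set and let $\mathcal F$ be an arbitrary operator sending $\boldsymbol u=(u_1,\dots,u_n)$ to functions $\mathcal F_1[\boldsymbol u],\dots,\mathcal F_N[\boldsymbol u]$. Consider $\mathcal F[\boldsymbol u]=\boldsymbol 0$ in $\Omega$ with, for each $j=1,\dots,n$, the boundary conditions $$a_i u_j+b_i\,(\boldsymbol n\cdot\nabla u_j)=g_i\quad\text{on }\gamma_i,\qquad i=1,\dots,m_j .$$ Here, for each $j$, $\gamma_1,\dots,\gamma_{m_j}$ are sets with union $\partial\Omega$ and pairwise positive distance; $\boldsymbol n$ is a field of unit vectors on $\gamma_i$ (e.g. the outward unit normal); and $\gamma_i,a_i,b_i,g_i,\boldsymbol n$ may depend on $j$ and $i$. The functions $a_i,b_i,g_i$ are given as continuous functions on $\Omega\cup\partial\Omega$ with $a_i^2+b_i^2\neq0$ there. The field $\boldsymbol n$ is extended to $\Omega\cup\partial\Omega$ so that it is continuous on $(\Omega\cup\partial\Omega)\setminus\gamma_i$ and, for every $x_0\in\gamma_i$ and $\delta>0$, every $x\in\Omega\cup\partial\Omega$ close enough to $x_0$ has $\boldsymbol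 n(x)$ at distance less than $\delta$ from the convex hull of $\{\boldsymbol n(y):y\in\gamma_i,\ |y-x_0|<\delta\}$ (any extension continuous on $\Omega\cup\partial\Omega$ qualifies). Put $\tilde{\boldsymbol n}=(a_i,b_i\boldsymbol n)/\sqrt{a_i^2+b_i^2}\in\mathbb R^{d+1}$, $\tilde g_i=g_i/\sqrt{a_i^2+b_i^2}$, $\boldsymbol B=\boldsymbol I_{d+1}-\tilde{\boldsymbol n}\tilde{\boldsymbol n}^\top$. Assume that on $\gamma_i$ there is an orthogonal diagonalization $\boldsymbol B=\boldsymbol P^\top\Lambda\boldsymbol P$, $\Lambda=\mathrm{diag}(\lambda_1,\dots,\lambda_d,0)$, $\lambda_1\ge\dots\ge\lambda_d>0$, with $\tilde{\boldsymbol n},\boldsymbol P,\Lambda$ piecewise continuous on $\gamma_i$ (i.e. $\gamma_i$ is a finite union of sets on each of which the function agrees with one that is continuous on the closure of that set). Let $l^{\partial\Omega}$ and $l^{\gamma_i}$ be continuous functions on $\Omega\cup\partial\Omega$ that vanish on $\partial\Omega$, respectively $\gamma_i$, and are positive elsewhere, with $l^{\gamma_i}\ge C_i>0$ on $\partial\Omega\setminus\gamma_i$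 for some constants $C_i$. Assume that $\boldsymbol u$ is a bounded solution of the boundary value problem, $C^1$ up to the boundary (each $u_j$ is differentiable in $\Omega$, and $u_j,\nabla u_j$ extend continuously to $\Omega\cup\partial\Omega$), and that it is the only solution that is $C^1$ up to the boundary. The networks are multilayer perceptrons whose activation function is continuous with two different finite limits at $\pm\infty$ (e.g. $\tanh$); each has a prescribed number $\ge1$ of hidden layers, and its parameters consist of the widths of its hidden layers, its weights and its biases. There are one main network $\mathrm{NN}_{\mathrm{main}}:\mathbb R^d\to(\mathbb R^{d+1})^n$, with blocks $\mathrm{NN}_{\mathrm{main},j}$, and for all $j,i$ a network $\mathrm{NN}_j^{\gamma_i}:\mathbb R^d\to\mathbb R^{d+1}$. For $\beta_s\in\mathbb R$ define $$(\hat u_j,\hat{\boldsymbol p}_j)=l^{\partial\Omega}\,\mathrm{NN}_{\mathrm{main},j}(\cdot;\theta_{\mathrm{main}})+\sum_{i=1}^{m_j}e^{-\alpha_i l^{\gamma_i}}\bigl(\boldsymbol B\,\mathrm{NN}_j^{\gamma_i}(\cdot;\theta_j^{\gamma_i})+\tilde{\boldsymbol n}\,\tilde g_i\bigr),\qquad \alpha_i=\frac{\beta_s}{\min_{\partial\Omega\setminus\gamma_i}l^{\gamma_i}},$$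 with $\alpha_i=0$ if $\gamma_i=\partial\Omega$. Then for every $\varepsilon>0$ there exist $\beta_s\in\mathbb R$ and parameters $\theta_{\mathrm{main}}$ and $\theta_j^{\gamma_i}$ ($j=1,\dots,n$, $i=1,\dots,m_j$) such that $$\bigl\|(\hat u_j,\hat{\boldsymbol p}_j)(x)-(u_j,\nabla u_j)(x)\bigr\|_1<\varepsilon\qquad\text{for all }x\in\Omega\cup\partial\Omega\text{ and all }j=1,\dots,n .$$ -/

import Mathlib

open Set Filter Topology

namespace HardConstraint

/-- Points and vectors of `ℝ^d`, with the Euclidean norm. -/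
abbrev Pt (d : ℕ) : Type := EuclideanSpace ℝ (Fin d)

/-! ### Multilayer perceptrons -/

/-- The parameters of a multilayer perceptron with `L` hidden layers, `k` inputs and outputs
indexed by `ι`. The widths of the hidden layers are free; each layer consists of a weight matrix
and a bias vector. -/
inductive MLP (ι : Type) : ℕ → ℕ → Type
  | output {k : ℕ} (A : Matrix ι (Fin k) ℝ) (b : ι → ℝ) : MLP ι 0 k
  | hidden {L k w : ℕ} (A : Matrix (Fin w) (Fin k) ℝ) (b : Fin w → ℝ) (θ : MLP ι L w) :
      MLP ι (L + 1) k

/-- The function computed by a multilayer perceptron: `x ↦ σ (A x + b)` (componentwise) in every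
hidden layer, `x ↦ A x + b` in the output layer. -/
def MLP.eval {ι : Type} (σ : ℝ → ℝ) : {L k : ℕ} → MLP ι L k → (Fin k → ℝ) → ι → ℝ
  | _, _, .output A b, x => A.mulVec x + b
  | _, _, .hidden A b θ, x => θ.eval σ (fun r => σ ((A.mulVec x + b) r))

/-- Admissible activation functions: continuous, with two different finite limits at `±∞`
(for instance `tanh` or the logistic function). -/
structure IsSigmoidal (σ : ℝ → ℝ) : Prop where
  continuous : Continuous σ
  limits : ∃ p q : ℝ, p ≠ q ∧ Tendsto σ atBot (𝓝 p) ∧ Tendsto σ atTop (𝓝 q)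

/-! ### Boundary conditions -/

/-- A piece `γ` of the boundary with a boundary condition `a u + b (n · ∇u) = g` on it, and an
extended distance function `l` of `γ`. The functions are used on all of `Ω ∪ ∂Ω`. -/
structure BoundaryPiece (d : ℕ) where
  γ : Set (Pt d)
  a : Pt d → ℝ
  b : Pt d → ℝ
  g : Pt d → ℝ
  n : Pt d → Pt d
  l : Pt d → ℝ

variable {d : ℕ}

/-- `l` is a continuous extended distance function of `S` on `Ω ∪ ∂Ω`: it vanishes on `S` and is
positive elsewhere. -/
structure IsExtendedDistance (Ω S : Set (Pt d)) (l : Pt d → ℝ) : Prop where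
  continuousOn : ContinuousOn l (closure Ω)
  eq_zero : ∀ x ∈ closure Ω, x ∈ S → l x = 0
  pos : ∀ x ∈ closure Ω, x ∉ S → 0 < l x

/-- The coefficient functions of a boundary condition extend from `γ` to `Ω ∪ ∂Ω`: `a`, `b`, `g`
are continuous with `a² + b² ≠ 0`; the vector field `n` may jump on `γ`, its extension is
continuous away from `γ` and close to `γ` it is, up to a small error, an average of values of `n`
at nearby points of `γ`. (If `n` is continuous on `Ω ∪ ∂Ω`, the last two conditions hold.) -/
structure BoundaryPiece.IsExtended (P : BoundaryPiece d) (Ω : Set (Pt d)) : Prop where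
  a_cont : ContinuousOn P.a (closure Ω)
  b_cont : ContinuousOn P.b (closure Ω)
  g_cont : ContinuousOn P.g (closure Ω)
  nondegenerate : ∀ x ∈ closure Ω, P.a x ^ 2 + P.b x ^ 2 ≠ 0
  n_cont : ContinuousOn P.n (closure Ω \ P.γ)
  n_average : ∀ x₀ ∈ P.γ, ∀ δ > 0, ∀ᶠ x in 𝓝[closure Ω] x₀,
    ∃ v ∈ convexHull ℝ (P.n '' (P.γ ∩ Metric.ball x₀ δ)), dist (P.n x) v < δ

namespace BoundaryPiece

variable (P : BoundaryPiece d)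

/-- `ñ = (a, b n) / √(a² + b²)`. -/
noncomputable def nTilde (x : Pt d) : Fin (d + 1) → ℝ :=
  (√(P.a x ^ 2 + P.b x ^ 2))⁻¹ • (Fin.cons (P.a x) (fun k => P.b x * P.n x k) : Fin (d + 1) → ℝ)

/-- `g̃ = g / √(a² + b²)`. -/
noncomputable def gTilde (x : Pt d) : ℝ := P.g x / √(P.a x ^ 2 + P.b x ^ 2)

/-- `B = I - ñ ñᵀ`. -/
noncomputable def B (x : Pt d) : Matrix (Fin (d + 1)) (Fin (d + 1)) ℝ :=
  1 - Matrix.vecMulVec (P.nTilde x) (P.nTilde x)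

/-- The general solution `B NN + ñ g̃` of the boundary condition, with a network `NN`. -/
noncomputable def pTilde (σ : ℝ → ℝ) {L : ℕ} (θ : MLP (Fin (d + 1)) L d) (x : Pt d) :
    Fin (d + 1) → ℝ :=
  (P.B x).mulVec (θ.eval σ x.ofLp) + P.gTilde x • P.nTilde x

/-- `α = β_s / min_{∂Ω ∖ γ} l`. If `γ = ∂Ω`, the minimum is over the empty set, and `α = 0`
(the value for `min ∅ = ∞`; here it comes from `sInf ∅ = 0` and `β_s / 0 = 0`). -/
noncomputable def alpha (Ω : Set (Pt d)) (βs : ℝ) : ℝ :=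
  βs / sInf (P.l '' (frontier Ω \ P.γ))

end BoundaryPiece

/-- The pair `(u, p)` as a vector of `ℝ^(d+1)`. -/
def pair (u : ℝ) (p : Pt d) : Fin (d + 1) → ℝ := Fin.cons u p.ofLp

/-- The hard-constraint ansatz `(û_j, p̂_j)`. The main network has `n` blocks of `d + 1` outputs,
the `j`-th of which is used for the `j`-th unknown. -/
noncomputable def ansatz {n : ℕ} (Ω : Set (Pt d)) (lΩ : Pt d → ℝ) {m : Fin n → ℕ}
    (bc : ∀ j, Fin (m j) → BoundaryPiece d) (σ : ℝ → ℝ) (βs : ℝ)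
    {L₀ : ℕ} (θmain : MLP (Fin n × Fin (d + 1)) L₀ d)
    {L : ∀ j, Fin (m j) → ℕ} (θ : ∀ j i, MLP (Fin (d + 1)) (L j i) d)
    (j : Fin n) (x : Pt d) : Fin (d + 1) → ℝ :=
  lΩ x • (fun k => θmain.eval σ x.ofLp (j, k)) +
    ∑ i, Real.exp (-((bc j i).alpha Ω βs) * (bc j i).l x) • (bc j i).pTilde σ (θ j i) x

/-! ### Solutions and regularity -/

/-- `u` is a `C¹` function on `Ω ∪ ∂Ω` with gradient field `Du` there: `u` is differentiable in
the open set `Ω`, and `u` and its gradient extend continuously to `∂Ω`. -/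
structure IsC1With (Ω : Set (Pt d)) (u : Pt d → ℝ) (Du : Pt d → Pt d) : Prop where
  cont : ContinuousOn u (closure Ω)
  grad_cont : ContinuousOn Du (closure Ω)
  grad : ∀ x ∈ Ω, HasGradientAt u (Du x) x

/-- `u = (u_1, …, u_n)`, with gradients `Du`, is a `C¹` solution of the equations
`F_k[u] = 0` in `Ω` with the given boundary conditions. The operator `F` is arbitrary: it sends
the tuple of functions `u` to the tuple of functions `F_k[u]`. -/
structure IsSolution {n N : ℕ} (Ω : Set (Pt d)) (F : (Fin n → Pt d → ℝ) → Fin N → Pt d → ℝ)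
    {m : Fin n → ℕ} (bc : ∀ j, Fin (m j) → BoundaryPiece d)
    (u : Fin n → Pt d → ℝ) (Du : Fin n → Pt d → Pt d) : Prop where
  c1 : ∀ j, IsC1With Ω (u j) (Du j)
  equation : ∀ k, ∀ x ∈ Ω, F u k x = 0
  boundary : ∀ j i, ∀ x ∈ (bc j i).γ,
    (bc j i).a x * u j x + (bc j i).b x * inner ℝ ((bc j i).n x) (Du j x) = (bc j i).g x

/-- `f` is piecewise continuous on `S`: `S` is a finite union of sets on each of which `f` agrees
with a function that is continuous on the closure of that set. -/
def PiecewiseContinuousOn {X Y : Type*} [TopologicalSpace X] [TopologicalSpace Y]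
    (f : X → Y) (S : Set X) : Prop :=
  ∃ (K : ℕ) (T : Fin K → Set X), S = ⋃ k, T k ∧
    ∀ k, ∃ f' : X → Y, ContinuousOn f' (closure (T k)) ∧ EqOn f f' (T k)

/-- On `γ` there is an orthogonal diagonalization `B = Pᵀ Λ P` with
`Λ = diag(λ_1, …, λ_d, 0)`, `λ_1 ≥ ⋯ ≥ λ_d > 0`, such that `ñ`, `P` and `Λ` are piecewise
continuous on `γ`. -/
def BoundaryPiece.PiecewiseDiagonalizable (P : BoundaryPiece d) : Prop :=
  PiecewiseContinuousOn P.nTilde P.γ ∧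
  ∃ (Q : Pt d → Matrix (Fin (d + 1)) (Fin (d + 1)) ℝ) (lam : Pt d → Fin d → ℝ),
    PiecewiseContinuousOn Q P.γ ∧ PiecewiseContinuousOn lam P.γ ∧
    ∀ x ∈ P.γ, Q x ∈ Matrix.orthogonalGroup (Fin (d + 1)) ℝ ∧
      Antitone (lam x) ∧ (∀ k, 0 < lam x k) ∧
      P.B x = (Q x).transpose *
        Matrix.diagonal (Fin.snoc (lam x) 0 : Fin (d + 1) → ℝ) * Q x

end HardConstraint

open HardConstraint

/-!
Write `p = (u_j, ∇u_j)`, a continuous function on the compact set `K = Ω ∪ ∂Ω`. With `p` itself in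
place of the network of the boundary piece `γ_i`, the general solution of the boundary condition is
`q_i = B p + ñ g̃ = p + (g̃ - ñ · p) ñ`. On `γ_i` the factor `g̃ - ñ · p` is zero, because `u_j`
satisfies the boundary condition there; so `q_i = p` on `γ_i`. The field `n` may jump on `γ_i`, but
near `γ_i` it is close to an average of its values at nearby points of `γ_i`, and the boundary
condition is affine in `n`. Hence `g̃ - ñ · p` still tends to `0` at `γ_i`
(`tendsto_sub_inner_of_average`), and as `ñ` is bounded, `q_i` is continuous on `K`
(`IsExtended.continuousOn_exactSolution`).

At a point of `γ_i` the `i`-th weight `exp (-α l)` is `1` and the other ones are at most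
`exp (-β_s)`. So for large `β_s` the residual `R = p - ∑ i, exp (-α_i l_i) q_i` is small on `∂Ω`
(`eventually_norm_sub_sum_lt`). A continuous function on `K` that is small on the zero set `∂Ω` of
`l^∂Ω` is uniformly close to `l^∂Ω f` for some continuous `f` (`exists_norm_smul_sub_lt`).

It remains to choose a main network close to `f` and, for each piece, a network close to `p`; the
projection `B` is bounded, so the latter gives a function close to `q_i`. This uses universal
approximation for any number of hidden layers (`exists_mlp_approx`). For one hidden layer, sums of
steep sigmoids approximate continuous functions of one variable, so the closed span of the neurons
contains all functions `x ↦ exp (a · x)`, and these span a dense subalgebra by the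
Stone–Weierstrass theorem. A further layer is added by letting it approximate the identity.
-/

namespace HardConstraint

/-! ### Universal approximation -/

theorem IsSigmoidal.exists_norm_le {σ : ℝ → ℝ} (hσ : IsSigmoidal σ) : ∃ C, ∀ s, |σ s| ≤ C := by
  obtain ⟨p, q, -, hp, hq⟩ := hσ.limits
  obtain ⟨s, hs⟩ := eventually_atBot.1 (hp.abs.eventually_lt_const (lt_add_one |p|))
  obtain ⟨t, ht⟩ := eventually_atTop.1 (hq.abs.eventually_lt_const (lt_add_one |q|))
  obtain ⟨C, hC⟩ := (isCompact_Icc (a := s) (b := t)).exists_bound_of_continuousOn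
    hσ.continuous.continuousOn
  refine ⟨max C (max (|p| + 1) (|q| + 1)), fun r => ?_⟩
  rcases le_total r s with h | h
  · exact (hs r h).le.trans ((le_max_left _ _).trans (le_max_right _ _))
  rcases le_total t r with h' | h'
  · exact (ht r h').le.trans ((le_max_right _ _).trans (le_max_right _ _))
  · exact (hC r ⟨h, h'⟩).trans (le_max_left _ _)

/-- A continuous function is approximated by a staircase of small steps, each step being a steep
sigmoid. At a given point only the two nearest steps can be far from their limits, and each of
them contributes at most a multiple of the step height. -/
theorem exists_staircase_approx {τ h : ℝ → ℝ} {C R ε : ℝ} (hτ0 : Tendsto τ atBot (𝓝 0))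
    (hτ1 : Tendsto τ atTop (𝓝 1)) (hC : ∀ s, |τ s| ≤ C) (hh : Continuous h) (hR : 0 < R)
    (hε : 0 < ε) :
    ∃ (M : ℕ) (c₀ N : ℝ) (c t : ℕ → ℝ), ∀ s ∈ Icc (-R) R,
      |c₀ + ∑ k ∈ Finset.range M, c k * τ (N * s + t k) - h s| < ε := by
  have hC0 : 0 ≤ C := (abs_nonneg _).trans (hC 0)
  -- the errors below add up to at most `(2 * C + 4) * e`
  set e : ℝ := ε / (2 * C + 5) with he
  have he0 : 0 < e := by positivity
  have huc := (isCompact_Icc (a := -R) (b := R)).uniformContinuousOn_of_continuous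
    hh.continuousOn
  obtain ⟨δ, hδ, hhδ⟩ := Metric.uniformContinuousOn_iff.1 huc e he0
  obtain ⟨M, hM⟩ := exists_nat_gt (2 * R / δ)
  have hM0 : (0 : ℝ) < M := lt_trans (by positivity) hM
  set η : ℝ := 2 * R / M with hη
  have hη0 : 0 < η := by positivity
  have hηδ : η < δ := by
    have h1 : 2 * R < M * δ := (div_lt_iff₀ hδ).1 (by linarith)
    rw [hη, div_lt_iff₀ hM0]; linarith
  have hMη : M * η = 2 * R := by rw [hη]; field_simp
  set x : ℕ → ℝ := fun k => -R + k * η with hx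
  obtain ⟨A, hA⟩ := eventually_atBot.1
    ((Metric.tendsto_nhds.1 hτ0) (1 / M) (by positivity))
  obtain ⟨A', hA'⟩ := eventually_atTop.1
    ((Metric.tendsto_nhds.1 hτ1) (1 / M) (by positivity))
  -- so steep that at distance `η` from its step a sigmoid is within `1 / M` of its limit
  set N : ℝ := (|A| + |A'|) / η with hN
  have hNη : N * η = |A| + |A'| := by rw [hN]; field_simp
  have hN0 : 0 ≤ N := by positivity
  refine ⟨M, h (x 0), N, fun k => h (x (k + 1)) - h (x k), fun k => -(N * x (k + 1)), ?_⟩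
  intro s hs
  obtain ⟨hs1, hs2⟩ := hs
  -- `x m ≤ s < x (m + 1)`
  set m : ℕ := ⌊(s + R) / η⌋₊ with hm
  have hm1 : x m ≤ s := by
    have : (m : ℝ) ≤ (s + R) / η := Nat.floor_le (div_nonneg (by linarith) hη0.le)
    rw [le_div_iff₀ hη0] at this
    simp only [hx]; linarith
  have hm2 : s < x (m + 1) := by
    have : (s + R) / η < (m : ℝ) + 1 := Nat.lt_floor_add_one _
    rw [div_lt_iff₀ hη0] at this
    simp only [hx]; push_cast; linarith
  have hmM : m ≤ M := by
    have h1 : (m : ℝ) * η ≤ M * η := by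
      have : x m ≤ s := hm1
      simp only [hx] at this
      linarith
    exact_mod_cast le_of_mul_le_mul_right h1 hη0
  have hxmem : ∀ k ≤ M, x k ∈ Icc (-R) R := by
    intro k hk
    have h1 : (k : ℝ) * η ≤ M * η := mul_le_mul_of_nonneg_right (by exact_mod_cast hk) hη0.le
    have h2 : 0 ≤ (k : ℝ) * η := by positivity
    constructor <;> simp only [hx] <;> linarith
  have hstep : ∀ k < M, |h (x (k + 1)) - h (x k)| < e := by
    intro k hk
    refine hhδ _ (hxmem _ hk) _ (hxmem _ hk.le) ?_
    rw [Real.dist_eq]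
    have : x (k + 1) - x k = η := by simp only [hx]; push_cast; ring
    rw [this, abs_of_pos hη0]; exact hηδ
  have hlast : |h (x m) - h s| < e := by
    refine hhδ _ (hxmem _ hmM) _ ⟨hs1, hs2⟩ ?_
    rw [Real.dist_eq, abs_sub_lt_iff]
    have : x (m + 1) = x m + η := by simp only [hx]; push_cast; ring
    constructor <;> linarith
  have htel : h (x m) = h (x 0) + ∑ k ∈ Finset.range M,
      (h (x (k + 1)) - h (x k)) * (if k < m then 1 else 0) := by
    have h1 : ∑ k ∈ Finset.range M, (h (x (k + 1)) - h (x k)) * (if k < m then (1 : ℝ) else 0)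
        = ∑ k ∈ Finset.range m, (h (x (k + 1)) - h (x k)) := by
      simp only [mul_ite, mul_one, mul_zero]
      rw [← Finset.sum_filter]
      congr 1
      ext k
      simp only [Finset.mem_filter, Finset.mem_range]
      omega
    rw [h1, Finset.sum_range_sub (fun k => h (x k))]; ring
  have hterm : ∀ k ∈ Finset.range M,
      |(h (x (k + 1)) - h (x k)) * (τ (N * s + -(N * x (k + 1))) - if k < m then 1 else 0)|
        ≤ e * (1 / M) + ((if k = m then e * (C + 1) else 0)
          + if k + 1 = m then e * (C + 1) else 0) := by
    intro k hk
    have hk := Finset.mem_range.1 hk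
    have hxx : x (k + 1) = -R + (k + 1) * η := by simp only [hx]; push_cast; ring
    have hxm : x m = -R + m * η := rfl
    have hxm1 : x (m + 1) = -R + (m + 1) * η := by simp only [hx]; push_cast; ring
    rw [abs_mul]
    by_cases hn : k = m ∨ k + 1 = m
    · have hb : |τ (N * s + -(N * x (k + 1))) - if k < m then 1 else 0| ≤ C + 1 := by
        refine (abs_sub _ _).trans (add_le_add (hC _) ?_)
        split_ifs <;> simp
      have h1 := mul_le_mul (hstep k hk).le hb (abs_nonneg _) he0.le
      have h2 : 0 ≤ e * (1 / M) := by positivity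
      have h3 : 0 ≤ e * (C + 1) := by positivity
      refine h1.trans ?_
      rcases hn with hn | hn
      · rw [if_pos hn]
        split_ifs <;> linarith
      · rw [if_pos hn]
        split_ifs <;> linarith
    · rw [not_or] at hn
      rw [if_neg hn.1, if_neg hn.2, add_zero, add_zero]
      refine mul_le_mul (hstep k hk).le ?_ (abs_nonneg _) he0.le
      split_ifs with hkm
      · have hk2 : ((k : ℝ) + 2) ≤ m := by exact_mod_cast (show k + 2 ≤ m by omega)
        have h1 : η ≤ s - x (k + 1) := by
          have := mul_le_mul_of_nonneg_right hk2 hη0.le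
          rw [hxx]; linarith
        have h2 : N * η ≤ N * (s - x (k + 1)) := mul_le_mul_of_nonneg_left h1 hN0
        have h3 := hA' (N * s + -(N * x (k + 1)))
          (by linarith [le_abs_self A', abs_nonneg A])
        rw [Real.dist_eq] at h3
        exact h3.le
      · have hk2 : (m : ℝ) + 1 ≤ k := by exact_mod_cast (show m + 1 ≤ k by omega)
        have h1 : η ≤ x (k + 1) - s := by
          have := mul_le_mul_of_nonneg_right hk2 hη0.le
          rw [hxx]; linarith
        have h2 : N * η ≤ N * (x (k + 1) - s) := mul_le_mul_of_nonneg_left h1 hN0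
        have h3 := hA (N * s + -(N * x (k + 1)))
          (by linarith [neg_abs_le A, abs_nonneg A'])
        rw [Real.dist_eq] at h3
        exact h3.le
  have hsum : ∑ k ∈ Finset.range M, (e * (1 / M) + ((if k = m then e * (C + 1) else 0)
      + if k + 1 = m then e * (C + 1) else 0)) ≤ e + (e * (C + 1) + e * (C + 1)) := by
    rw [Finset.sum_add_distrib, Finset.sum_add_distrib]
    have h3 : 0 ≤ e * (C + 1) := by positivity
    refine add_le_add (le_of_eq ?_) (add_le_add ?_ ?_)
    · rw [Finset.sum_const, Finset.card_range, nsmul_eq_mul]; field_simp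
    · rw [Finset.sum_ite_eq']
      split_ifs <;> linarith
    · rcases m with _ | m'
      · simpa using h3
      · simp only [Nat.add_right_cancel_iff]
        rw [Finset.sum_ite_eq']
        split_ifs <;> linarith
  have hsplit : h (x 0) + ∑ k ∈ Finset.range M,
        (h (x (k + 1)) - h (x k)) * τ (N * s + -(N * x (k + 1))) - h s
      = ∑ k ∈ Finset.range M, (h (x (k + 1)) - h (x k)) *
          (τ (N * s + -(N * x (k + 1))) - if k < m then 1 else 0) + (h (x m) - h s) := by
    rw [htel]
    simp only [mul_sub, Finset.sum_sub_distrib]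
    ring
  rw [hsplit]
  have hfin : e * (2 * C + 5) = ε := by rw [he]; field_simp
  have h1 := (Finset.abs_sum_le_sum_abs _ _).trans ((Finset.sum_le_sum hterm).trans hsum)
  have h2 := abs_add_le (∑ k ∈ Finset.range M, (h (x (k + 1)) - h (x k)) *
          (τ (N * s + -(N * x (k + 1))) - if k < m then 1 else 0)) (h (x m) - h s)
  have h3 : 0 ≤ e * C := by positivity
  linarith

/-- The function computed by a single neuron, `x ↦ σ (a · x + b)`, on a set `K`. -/
def neuron {σ : ℝ → ℝ} (hσ : Continuous σ) {k : ℕ} (K : Set (Fin k → ℝ))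
    (w : (Fin k → ℝ) × ℝ) : C(K, ℝ) :=
  ⟨fun x => σ (w.1 ⬝ᵥ x.1 + w.2),
    hσ.comp ((continuous_const.dotProduct continuous_subtype_val).add continuous_const)⟩

section Shallow

variable {σ : ℝ → ℝ} {k : ℕ} {K : Set (Fin k → ℝ)}

/-- Neurons with weight `0` give the constants, as `σ` is not identically zero. -/
theorem one_mem_span_neuron (hσ : IsSigmoidal σ) :
    (1 : C(K, ℝ)) ∈ Submodule.span ℝ (range (neuron hσ.continuous K)) := by
  obtain ⟨b, hb⟩ : ∃ b, σ b ≠ 0 := by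
    by_contra! h
    obtain ⟨p, q, hpq, hp, hq⟩ := hσ.limits
    rw [show σ = fun _ => 0 from funext h] at hp hq
    exact hpq ((tendsto_nhds_unique hp tendsto_const_nhds).trans
      (tendsto_nhds_unique tendsto_const_nhds hq))
  have : (1 : C(K, ℝ)) = (σ b)⁻¹ • neuron hσ.continuous K (0, b) := by
    ext x
    simp [neuron, hb]
  rw [this]
  exact Submodule.smul_mem _ _ (Submodule.subset_span ⟨_, rfl⟩)

theorem ridge_mem_closure_span_neuron (hσ : IsSigmoidal σ) [CompactSpace K] {h : ℝ → ℝ}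
    (hh : Continuous h) (a : Fin k → ℝ) (f : C(K, ℝ)) (hf : ∀ x : K, f x = h (a ⬝ᵥ x.1)) :
    f ∈ (Submodule.span ℝ (range (neuron hσ.continuous K))).topologicalClosure := by
  obtain ⟨p, q, hpq, hp, hq⟩ := hσ.limits
  obtain ⟨C, hC⟩ := hσ.exists_norm_le
  have hqp : q - p ≠ 0 := sub_ne_zero.2 hpq.symm
  -- rescale `σ` so that its limits are `0` and `1`
  set τ : ℝ → ℝ := fun s => (q - p)⁻¹ * (σ s - p) with hτ
  have hτ0 : Tendsto τ atBot (𝓝 0) := by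
    simpa using (hp.sub_const p).const_mul (q - p)⁻¹
  have hτ1 : Tendsto τ atTop (𝓝 1) := by
    simpa [hqp] using (hq.sub_const p).const_mul (q - p)⁻¹
  have hτC : ∀ s, |τ s| ≤ |(q - p)⁻¹| * (C + |p|) := fun s => by
    rw [hτ, abs_mul]
    exact mul_le_mul_of_nonneg_left ((abs_sub _ _).trans (add_le_add (hC s) le_rfl))
      (abs_nonneg _)
  let ℓ : C(K, ℝ) := ⟨fun x => a ⬝ᵥ x.1, continuous_const.dotProduct continuous_subtype_val⟩
  have hℓ : ∀ x : K, a ⬝ᵥ x.1 ∈ Icc (-(‖ℓ‖ + 1)) (‖ℓ‖ + 1) := fun x => by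
    have := abs_le.1 (ℓ.norm_coe_le_norm x)
    exact ⟨by linarith [this.1, show ℓ x = a ⬝ᵥ x.1 from rfl],
      by linarith [this.2, show ℓ x = a ⬝ᵥ x.1 from rfl]⟩
  rw [← SetLike.mem_coe, Submodule.topologicalClosure_coe, Metric.mem_closure_iff]
  intro ε hε
  obtain ⟨M, c₀, N, c, t, H⟩ := exists_staircase_approx hτ0 hτ1 hτC hh
    (R := ‖ℓ‖ + 1) (by positivity) hε
  refine ⟨c₀ • 1 + ∑ r ∈ Finset.range M, (c r * (q - p)⁻¹) •
    (neuron hσ.continuous K (N • a, t r) - p • 1), ?_, ?_⟩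
  · refine Submodule.add_mem _ (Submodule.smul_mem _ _ (one_mem_span_neuron hσ))
      (Submodule.sum_mem _ fun r _ => Submodule.smul_mem _ _ (Submodule.sub_mem _
        (Submodule.subset_span ⟨_, rfl⟩) (Submodule.smul_mem _ _ (one_mem_span_neuron hσ))))
  · rw [dist_comm, ContinuousMap.dist_lt_iff hε]
    intro x
    have := H _ (hℓ x)
    rw [Real.dist_eq, hf]
    convert this using 4
    simp [neuron, hτ, mul_assoc]

/-- The exponentials `x ↦ exp (a · x)`, as a monoid homomorphism in `a`. -/
noncomputable def expRidge (K : Set (Fin k → ℝ)) : Multiplicative (Fin k → ℝ) →* C(K, ℝ) where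
  toFun a := ⟨fun x => Real.exp (a.toAdd ⬝ᵥ x.1),
    Real.continuous_exp.comp (continuous_const.dotProduct continuous_subtype_val)⟩
  map_one' := by ext x; simp
  map_mul' a b := by ext x; simp [Real.exp_add, add_dotProduct]

/-- The exponentials of linear forms are closed under products and separate points, so their
linear span is dense by the Stone–Weierstrass theorem; and each of them is a ridge function. -/
theorem closure_span_neuron_eq_top (hσ : IsSigmoidal σ) [CompactSpace K] :
    (Submodule.span ℝ (range (neuron hσ.continuous K))).topologicalClosure = ⊤ := by
  set V := (Submodule.span ℝ (range (neuron hσ.continuous K))).topologicalClosure with hV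
  set S := Algebra.adjoin ℝ (MonoidHom.mrange (expRidge K) : Set C(K, ℝ)) with hS
  have hsep : S.SeparatesPoints := by
    intro x y hxy
    obtain ⟨i, hi⟩ : ∃ i, x.1 i ≠ y.1 i := by
      by_contra! h
      exact hxy (Subtype.ext (funext h))
    refine ⟨_, ⟨expRidge K (Multiplicative.ofAdd (Pi.single i 1)),
      Algebra.subset_adjoin ⟨_, rfl⟩, rfl⟩, ?_⟩
    simpa [expRidge] using hi
  have hSV : Subalgebra.toSubmodule S ≤ V := by
    rw [hS, Algebra.adjoin_eq_span, Submonoid.closure_eq, Submodule.span_le]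
    rintro _ ⟨a, rfl⟩
    exact ridge_mem_closure_span_neuron hσ Real.continuous_exp a.toAdd _ fun x => rfl
  have htop := ContinuousMap.subalgebra_topologicalClosure_eq_top_of_separatesPoints S hsep
  rw [eq_top_iff]
  intro f _
  have hf : f ∈ closure (S : Set C(K, ℝ)) := by
    rw [← Subalgebra.topologicalClosure_coe, htop]; trivial
  exact closure_minimal (fun g hg => hSV hg)
    (Submodule.isClosed_topologicalClosure _) hf

/-- Universal approximation with one hidden layer and without a bias in the output layer. -/
theorem exists_shallow_approx (hσ : IsSigmoidal σ) (hK : IsCompact K) {ι : Type} [Finite ι]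
    {f : (Fin k → ℝ) → ι → ℝ} (hf : Continuous f) {ε : ℝ} (hε : 0 < ε) :
    ∃ (w : ℕ) (A : Matrix (Fin w) (Fin k) ℝ) (b : Fin w → ℝ) (A' : Matrix ι (Fin w) ℝ),
      ∀ x ∈ K, ∀ i, |A'.mulVec (fun r => σ ((A.mulVec x + b) r)) i - f x i| < ε := by
  classical
  have := Fintype.ofFinite ι
  have : CompactSpace K := isCompact_iff_compactSpace.1 hK
  have h : ∀ i, ∃ c : ((Fin k → ℝ) × ℝ) →₀ ℝ, ∀ x : K,
      |(c.sum fun w y => y * neuron hσ.continuous K w x) - f x i| < ε := by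
    intro i
    let fi : C(K, ℝ) := ⟨fun x => f x i, by fun_prop⟩
    have hfi : fi ∈ (Submodule.span ℝ (range (neuron hσ.continuous K))).topologicalClosure := by
      rw [closure_span_neuron_eq_top hσ]; trivial
    rw [← SetLike.mem_coe, Submodule.topologicalClosure_coe, Metric.mem_closure_iff] at hfi
    obtain ⟨g, hg, hfg⟩ := hfi ε hε
    obtain ⟨c, rfl⟩ := (Finsupp.mem_span_range_iff_exists_finsupp).1 hg
    refine ⟨c, fun x => ?_⟩
    rw [dist_comm, ContinuousMap.dist_lt_iff hε] at hfg
    have := hfg x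
    rw [Real.dist_eq] at this
    convert this using 3
    · simp [Finsupp.sum]
    · rfl
  choose c hc using h
  -- one neuron for each weight that is used by some component
  set T : Finset ((Fin k → ℝ) × ℝ) := Finset.univ.biUnion fun i => (c i).support with hT
  let E : Fin T.card ≃ T := T.equivFin.symm
  refine ⟨T.card, fun r => (E r).1.1, fun r => (E r).1.2, fun i r => c i (E r).1, ?_⟩
  intro x hx i
  convert hc i ⟨x, hx⟩ using 3
  rw [Finsupp.sum_of_support_subset (s := T) _ (Finset.subset_biUnion_of_mem
    (fun i => (c i).support) (Finset.mem_univ i)) _ (by simp), ← Finset.sum_coe_sort,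
    ← E.sum_comp]
  rfl

end Shallow

/-- Universal approximation with any number `L + 1` of hidden layers. The first hidden layer,
followed by a linear map, approximates the identity of `K`, so it remains to approximate the
composition of `f` with that linear map on the image of the first layer. -/
theorem exists_mlp_approx {σ : ℝ → ℝ} (hσ : IsSigmoidal σ) {ι : Type} [Finite ι] (L : ℕ) :
    ∀ {k : ℕ} {K : Set (Fin k → ℝ)} (_ : IsCompact K) {f : (Fin k → ℝ) → ι → ℝ}
      (_ : Continuous f) {ε : ℝ} (_ : 0 < ε),
      ∃ θ : MLP ι (L + 1) k, ∀ x ∈ K, ∀ i, |θ.eval σ x i - f x i| < ε := by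
  have := Fintype.ofFinite ι
  induction L with
  | zero =>
    intro k K hK f hf ε hε
    obtain ⟨w, A, b, A', h⟩ := exists_shallow_approx hσ hK hf hε
    exact ⟨.hidden A b (.output A' 0), fun x hx i => by simpa [MLP.eval] using h x hx i⟩
  | succ L ih =>
    intro k K hK f hf ε hε
    have huc := hK.uniformContinuousAt_of_continuousAt f (fun x _ => hf.continuousAt)
      (Metric.dist_mem_uniformity (half_pos hε))
    obtain ⟨δ, hδ, hfδ⟩ := Metric.mem_uniformity_dist.1 huc
    obtain ⟨w, A, b, A', h⟩ := exists_shallow_approx hσ hK continuous_id hδ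
    have hσc := hσ.continuous
    have hΦ : Continuous fun x : Fin k → ℝ => fun r => σ ((A.mulVec x + b) r) := by
      unfold Matrix.mulVec dotProduct; fun_prop
    have hg : Continuous fun y : Fin w → ℝ => f (A'.mulVec y) :=
      hf.comp (by unfold Matrix.mulVec dotProduct; fun_prop)
    obtain ⟨θ, hθ⟩ := ih (hK.image hΦ) hg (half_pos hε)
    refine ⟨.hidden A b θ, fun x hx i => ?_⟩
    have h1 := hθ _ (mem_image_of_mem _ hx) i
    have h2 : dist x (A'.mulVec fun r => σ ((A.mulVec x + b) r)) < δ := by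
      rw [dist_comm, dist_pi_lt_iff hδ]
      exact fun r => h x hx r
    have h3 := (dist_pi_lt_iff (half_pos hε)).1 (hfδ h2 hx) i
    rw [dist_comm, Real.dist_eq] at h3
    rw [MLP.eval]
    have h4 := abs_sub_le (θ.eval σ (fun r => σ ((A.mulVec x + b) r)) i)
      (f (A'.mulVec fun r => σ ((A.mulVec x + b) r)) i) (f x i)
    linarith

/-- Universal approximation of functions that are continuous on a compact set of `ℝ^d`. -/
theorem exists_mlp_approx_on {σ : ℝ → ℝ} (hσ : IsSigmoidal σ) {ι : Type} [Finite ι] {L : ℕ}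
    (hL : 1 ≤ L) {d : ℕ} {K : Set (Pt d)} (hK : IsCompact K) {f : Pt d → ι → ℝ}
    (hf : ContinuousOn f K) {ε : ℝ} (hε : 0 < ε) :
    ∃ θ : MLP ι L d, ∀ x ∈ K, ∀ i, |θ.eval σ x.ofLp i - f x i| < ε := by
  obtain ⟨L, rfl⟩ := Nat.exists_eq_add_of_le' hL
  obtain ⟨F, hF⟩ := ContinuousMap.exists_restrict_eq hK.isClosed
    (⟨K.domRestrict f, continuousOn_iff_continuous_domRestrict.1 hf⟩ : C(K, ι → ℝ))
  have hF' : ∀ x ∈ K, F x = f x := fun x hx => DFunLike.congr_fun hF ⟨x, hx⟩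
  obtain ⟨θ, hθ⟩ := exists_mlp_approx hσ (ι := ι) L
    (hK.image (PiLp.continuous_ofLp 2 _)) (F.continuous.comp (PiLp.continuous_toLp 2 _)) hε
  refine ⟨θ, fun x hx i => ?_⟩
  have := hθ _ (mem_image_of_mem _ hx) i
  rwa [Function.comp_apply, WithLp.toLp_ofLp, hF' x hx] at this

end HardConstraint

namespace HardConstraint

variable {d : ℕ}

/-! ### The boundary condition near a boundary piece -/

/-- If `G = ⟪n, W⟫` on `γ`, where `n` has values in the unit ball, and off `γ` the field `n` is
nearly an average of nearby values on `γ`, then `G - ⟪n, W⟫` tends to `0` at the points of `γ`: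
for fixed `x`, the vectors `v` with `|G x - ⟪v, W x⟫| ≤ ε` form a convex set, which contains the
values `n y` at nearby points `y` of `γ`, hence also their averages. -/
theorem tendsto_sub_inner_of_average {X E : Type*} [PseudoMetricSpace X] [NormedAddCommGroup E]
    [InnerProductSpace ℝ E] {K γ : Set X} (hγK : γ ⊆ K) {n : X → E} {G : X → ℝ} {W : X → E}
    {x₀ : X} (hn : ∀ y ∈ γ, ‖n y‖ ≤ 1) (hG : ContinuousWithinAt G K x₀)
    (hW : ContinuousWithinAt W K x₀) (heq : ∀ y ∈ γ, G y = inner ℝ (n y) (W y))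
    (havg : ∀ δ > 0, ∀ᶠ x in 𝓝[K] x₀,
      ∃ v ∈ convexHull ℝ (n '' (γ ∩ Metric.ball x₀ δ)), dist (n x) v < δ) :
    Tendsto (fun x => G x - inner ℝ (n x) (W x)) (𝓝[K] x₀) (𝓝 0) := by
  rw [Metric.tendsto_nhds]
  intro ε hε
  have hG' := Metric.tendsto_nhds.1 hG (ε / 8) (by positivity)
  have hW' := Metric.tendsto_nhds.1 hW (min 1 (ε / 8)) (by positivity)
  obtain ⟨δ₁, hδ₁, hnear⟩ := Metric.mem_nhdsWithin_iff.1 (hG'.and hW')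
  set δ : ℝ := min δ₁ (ε / (4 * (‖W x₀‖ + 1))) with hδ
  have hδ0 : 0 < δ := by positivity
  have hδW : δ * (‖W x₀‖ + 1) ≤ ε / 4 := by
    calc δ * (‖W x₀‖ + 1) ≤ ε / (4 * (‖W x₀‖ + 1)) * (‖W x₀‖ + 1) := by
          gcongr; exact min_le_right _ _
      _ = ε / 4 := by field_simp
  filter_upwards [havg δ hδ0, hG', hW'] with x ⟨v, hv, hxv⟩ hGx hWx
  have hhull : convexHull ℝ (n '' (γ ∩ Metric.ball x₀ δ)) ⊆
      {v | |G x - inner ℝ v (W x)| ≤ ε / 2} := by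
    refine convexHull_min ?_ ?_
    · rintro _ ⟨y, ⟨hyγ, hyδ⟩, rfl⟩
      obtain ⟨hGy, hWy⟩ := hnear
        ⟨Metric.ball_subset_ball (min_le_left _ _) hyδ, hγK hyγ⟩
      have h1 : G x - inner ℝ (n y) (W x) = (G x - G y) + inner ℝ (n y) (W y - W x) := by
        rw [inner_sub_right, heq y hyγ]; ring
      have h2 : |inner ℝ (n y) (W y - W x)| ≤ ‖W y - W x‖ := by
        refine (abs_real_inner_le_norm _ _).trans ?_
        exact mul_le_of_le_one_left (norm_nonneg _) (hn y hyγ)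
      have h3 : ‖W y - W x‖ < ε / 8 + ε / 8 := by
        rw [← dist_eq_norm]
        refine (dist_triangle_right _ _ (W x₀)).trans_lt (add_lt_add ?_ ?_)
        · exact hWy.trans_le (min_le_right _ _)
        · exact hWx.trans_le (min_le_right _ _)
      have h4 : |G x - G y| < ε / 8 + ε / 8 := by
        rw [← Real.dist_eq]
        exact (dist_triangle_right _ _ (G x₀)).trans_lt (add_lt_add hGx hGy)
      rw [mem_ofPred_eq, h1]
      have := abs_add_le (G x - G y) (inner ℝ (n y) (W y - W x))
      linarith
    · intro v hv w hw s t hs ht hst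
      rw [mem_ofPred_eq, abs_le] at *
      rw [inner_add_left, real_inner_smul_left, real_inner_smul_left]
      have h1 : G x = s * G x + t * G x := by rw [← add_mul, hst, one_mul]
      have h2 : ε / 2 = s * (ε / 2) + t * (ε / 2) := by rw [← add_mul, hst, one_mul]
      constructor <;> nlinarith
  have h1 : |G x - inner ℝ v (W x)| ≤ ε / 2 := hhull hv
  have h2 : |inner ℝ (n x - v) (W x)| ≤ ε / 4 := by
    refine (abs_real_inner_le_norm _ _).trans (le_trans ?_ hδW)
    rw [← dist_eq_norm]
    refine mul_le_mul hxv.le ?_ (norm_nonneg _) hδ0.le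
    have h3 := hWx.trans_le (min_le_left _ _)
    rw [dist_eq_norm] at h3
    have := norm_le_norm_add_norm_sub (W x₀) (W x)
    rw [norm_sub_rev] at this
    linarith
  have h3 : G x - inner ℝ (n x) (W x) = (G x - inner ℝ v (W x)) - inner ℝ (n x - v) (W x) := by
    rw [inner_sub_left]; ring
  rw [Real.dist_eq, sub_zero, h3]
  have := abs_sub (G x - inner ℝ v (W x)) (inner ℝ (n x - v) (W x))
  linarith

theorem BoundaryPiece.IsExtended.continuousWithinAt_n {P : BoundaryPiece d} {Ω : Set (Pt d)}
    (hP : P.IsExtended Ω) (hγ : IsClosed P.γ) {x : Pt d} (hx : x ∈ closure Ω) (hxγ : x ∉ P.γ) :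
    ContinuousWithinAt P.n (closure Ω) x :=
  (continuousWithinAt_inter (hγ.isOpen_compl.mem_nhds hxγ)).1 (hP.n_cont x ⟨hx, hxγ⟩)

/-- A field that is continuous off a closed set `γ`, bounded by `1` on `γ`, and near `γ` close to
averages of its values on `γ`, is bounded on compact sets. -/
theorem BoundaryPiece.IsExtended.exists_norm_n_le {P : BoundaryPiece d} {Ω : Set (Pt d)}
    (hP : P.IsExtended Ω) (hK : IsCompact (closure Ω)) (hγ : IsClosed P.γ)
    (hn : ∀ y ∈ P.γ, ‖P.n y‖ ≤ 1) : ∃ M, ∀ x ∈ closure Ω, ‖P.n x‖ ≤ M := by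
  refine hK.induction_on (p := fun s => ∃ M, ∀ x ∈ s, ‖P.n x‖ ≤ M) ⟨0, by simp⟩
    (fun s t hst ⟨M, hM⟩ => ⟨M, fun x hx => hM x (hst hx)⟩)
    (fun s t ⟨M, hM⟩ ⟨M', hM'⟩ => ⟨max M M', fun x hx => hx.elim
      (fun h => (hM x h).trans (le_max_left _ _)) fun h => (hM' x h).trans (le_max_right _ _)⟩) ?_
  intro x₀ hx₀
  by_cases h : x₀ ∈ P.γ
  · refine ⟨_, hP.n_average x₀ h 1 one_pos, 2, ?_⟩
    rintro x ⟨v, hv, hxv⟩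
    have hv1 : v ∈ Metric.closedBall (0 : Pt d) 1 := by
      refine convexHull_min ?_ (convex_closedBall _ _) hv
      rintro _ ⟨y, ⟨hy, -⟩, rfl⟩
      simpa using hn y hy
    rw [mem_closedBall_zero_iff] at hv1
    have := norm_le_norm_add_norm_sub' (P.n x) v
    rw [dist_eq_norm] at hxv
    linarith
  · have h1 := hP.continuousWithinAt_n hγ hx₀ h
    refine ⟨_, (h1.norm.eventually_lt_const (lt_add_one _)), ‖P.n x₀‖ + 1, fun x hx => ?_⟩
    exact (show ‖P.n x‖ < _ from hx).le

namespace BoundaryPiece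

variable (P : BoundaryPiece d)

theorem B_mulVec (x : Pt d) (v : Fin (d + 1) → ℝ) :
    (P.B x).mulVec v = v - (P.nTilde x ⬝ᵥ v) • P.nTilde x := by
  rw [B, Matrix.sub_mulVec, Matrix.one_mulVec, Matrix.vecMulVec_mulVec]
  ext k
  simp

theorem norm_nTilde_le {M : ℝ} {x : Pt d} (hM : ‖P.n x‖ ≤ M) : ‖P.nTilde x‖ ≤ 1 + M := by
  have hM0 : 0 ≤ M := (norm_nonneg _).trans hM
  set r := √(P.a x ^ 2 + P.b x ^ 2) with hr
  have ha : |r⁻¹ * P.a x| ≤ 1 := by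
    rw [abs_mul, abs_inv, abs_of_nonneg (Real.sqrt_nonneg _), inv_mul_eq_div]
    exact div_le_one_of_le₀ (Real.abs_le_sqrt (by nlinarith [sq_nonneg (P.b x)]))
      (Real.sqrt_nonneg _)
  have hb : |r⁻¹ * P.b x| ≤ 1 := by
    rw [abs_mul, abs_inv, abs_of_nonneg (Real.sqrt_nonneg _), inv_mul_eq_div]
    exact div_le_one_of_le₀ (Real.abs_le_sqrt (by nlinarith [sq_nonneg (P.a x)]))
      (Real.sqrt_nonneg _)
  rw [pi_norm_le_iff_of_nonneg (by positivity)]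
  intro k
  refine Fin.cases ?_ (fun k => ?_) k
  · simp only [nTilde, Pi.smul_apply, Fin.cons_zero, smul_eq_mul, Real.norm_eq_abs]
    linarith
  · simp only [nTilde, Pi.smul_apply, Fin.cons_succ, smul_eq_mul, Real.norm_eq_abs]
    rw [← mul_assoc, abs_mul]
    have h1 : |P.n x k| ≤ M := (PiLp.norm_apply_le (P.n x) k).trans hM
    have := mul_le_mul hb h1 (abs_nonneg _) zero_le_one
    linarith

/-- The general solution of the boundary condition, with the pair `(u, p)` itself in place of the
network: `B (u, p) + ñ g̃ = (u, p) + (g̃ - ñ · (u, p)) ñ`. -/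
noncomputable def exactSolution (u : Pt d → ℝ) (p : Pt d → Pt d) (x : Pt d) : Fin (d + 1) → ℝ :=
  pair (u x) (p x) + (P.gTilde x - P.nTilde x ⬝ᵥ pair (u x) (p x)) • P.nTilde x

theorem pTilde_eq {σ : ℝ → ℝ} {L : ℕ} (θ : MLP (Fin (d + 1)) L d) (u : Pt d → ℝ)
    (p : Pt d → Pt d) (x : Pt d) :
    P.pTilde σ θ x = P.exactSolution u p x +
      (P.B x).mulVec (θ.eval σ x.ofLp - pair (u x) (p x)) := by
  rw [pTilde, exactSolution, B_mulVec, B_mulVec, dotProduct_sub]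
  module

theorem gTilde_sub_dotProduct (x : Pt d) (u : ℝ) (p : Pt d) :
    P.gTilde x - P.nTilde x ⬝ᵥ pair u p = (√(P.a x ^ 2 + P.b x ^ 2))⁻¹ *
      ((P.g x - P.a x * u) - inner ℝ (P.n x) (P.b x • p)) := by
  have h : inner ℝ (P.n x) (P.b x • p) = ∑ k, P.b x * P.n x k * p k := by
    rw [PiLp.inner_apply]
    refine Finset.sum_congr rfl fun k _ => ?_
    simp; ring
  rw [h, gTilde, nTilde, smul_dotProduct, dotProduct, Fin.sum_univ_succ]
  simp only [pair, Fin.cons_zero, Fin.cons_succ, smul_eq_mul]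
  ring

variable {P}

theorem exactSolution_eq_pair {u : Pt d → ℝ} {p : Pt d → Pt d} {x : Pt d}
    (h : P.a x * u x + P.b x * inner ℝ (P.n x) (p x) = P.g x) :
    P.exactSolution u p x = pair (u x) (p x) := by
  rw [exactSolution, gTilde_sub_dotProduct, real_inner_smul_right, ← h]
  simp

theorem IsExtended.continuousOn_inv_sqrt {Ω : Set (Pt d)} (hP : P.IsExtended Ω) :
    ContinuousOn (fun x => (√(P.a x ^ 2 + P.b x ^ 2))⁻¹) (closure Ω) := by
  refine ContinuousOn.inv₀ (((hP.a_cont.pow 2).add (hP.b_cont.pow 2)).sqrt) fun x hx => ?_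
  rw [Real.sqrt_ne_zero']
  exact lt_of_le_of_ne (by positivity) (hP.nondegenerate x hx).symm

end BoundaryPiece

theorem continuousOn_pair {u : Pt d → ℝ} {p : Pt d → Pt d} {K : Set (Pt d)}
    (hu : ContinuousOn u K) (hp : ContinuousOn p K) :
    ContinuousOn (fun x => pair (u x) (p x)) K := by
  rw [continuousOn_pi]
  intro k
  refine Fin.cases ?_ (fun k => ?_) k
  · simpa [pair] using hu
  · simp only [pair, Fin.cons_succ]
    fun_prop

namespace BoundaryPiece

variable {P : BoundaryPiece d} {Ω : Set (Pt d)} {u : Pt d → ℝ} {p : Pt d → Pt d}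

/-- Although `ñ` may jump on `γ`, the exact solution is continuous: there its second summand
vanishes in the limit, as `(u, p)` satisfies the boundary condition on `γ`. -/
theorem IsExtended.continuousOn_exactSolution (hP : P.IsExtended Ω) (hK : IsCompact (closure Ω))
    (hγ : IsClosed P.γ) (hγK : P.γ ⊆ closure Ω) (hn : ∀ y ∈ P.γ, ‖P.n y‖ ≤ 1)
    (hu : ContinuousOn u (closure Ω)) (hp : ContinuousOn p (closure Ω))
    (hbc : ∀ x ∈ P.γ, P.a x * u x + P.b x * inner ℝ (P.n x) (p x) = P.g x) :
    ContinuousOn (P.exactSolution u p) (closure Ω) := by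
  obtain ⟨M, hM⟩ := hP.exists_norm_n_le hK hγ hn
  have hs := hP.continuousOn_inv_sqrt
  have hG : ContinuousOn (fun x => P.g x - P.a x * u x) (closure Ω) :=
    hP.g_cont.sub (hP.a_cont.mul hu)
  have hW : ContinuousOn (fun x => P.b x • p x) (closure Ω) := hP.b_cont.smul hp
  refine (continuousOn_pair hu hp).add fun x₀ hx₀ => ?_
  simp only [gTilde_sub_dotProduct]
  by_cases h : x₀ ∈ P.γ
  · have h0 := tendsto_sub_inner_of_average hγK hn (hG x₀ hx₀) (hW x₀ hx₀)
      (fun y hy => by rw [real_inner_smul_right, ← hbc y hy]; ring) (hP.n_average x₀ h)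
    have h1 := (hs x₀ hx₀).tendsto.mul h0
    rw [mul_zero] at h1
    have h2 : IsBoundedUnder (· ≤ ·) (𝓝[closure Ω] x₀) (norm ∘ P.nTilde) :=
      ⟨1 + M, eventually_map.2 <| eventually_of_mem self_mem_nhdsWithin
        fun x hx => P.norm_nTilde_le (hM x hx)⟩
    have h3 := h1.zero_smul_isBoundedUnder_le h2
    have hz : (√(P.a x₀ ^ 2 + P.b x₀ ^ 2))⁻¹ *
        ((P.g x₀ - P.a x₀ * u x₀) - inner ℝ (P.n x₀) (P.b x₀ • p x₀)) = 0 := by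
      rw [real_inner_smul_right, ← hbc x₀ h]
      simp
    simp only [ContinuousWithinAt, hz, zero_smul]
    exact h3
  · have h1 := hP.continuousWithinAt_n hγ hx₀ h
    refine ((hs x₀ hx₀).mul ((hG x₀ hx₀).sub (h1.inner (𝕜 := ℝ) (hW x₀ hx₀)))).smul ?_
    refine (hs x₀ hx₀).smul (continuousWithinAt_pi.2 fun k => ?_)
    refine Fin.cases ?_ (fun k => ?_) k
    · simpa using hP.a_cont x₀ hx₀
    · simp only [Fin.cons_succ]
      exact (hP.b_cont x₀ hx₀).mul
        (((PiLp.continuous_apply 2 _ k).continuousAt).comp_continuousWithinAt h1)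

/-- The projection `B` is bounded, so a network that is close to `(u, p)` gives a value close to
the exact solution. -/
theorem IsExtended.exists_pTilde_approx (hP : P.IsExtended Ω) (hK : IsCompact (closure Ω))
    (hγ : IsClosed P.γ) (hn : ∀ y ∈ P.γ, ‖P.n y‖ ≤ 1)
    (hu : ContinuousOn u (closure Ω)) (hp : ContinuousOn p (closure Ω))
    {σ : ℝ → ℝ} (hσ : IsSigmoidal σ) {L : ℕ} (hL : 1 ≤ L) {η : ℝ} (hη : 0 < η) :
    ∃ θ : MLP (Fin (d + 1)) L d, ∀ x ∈ closure Ω,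
      ‖P.pTilde σ θ x - P.exactSolution u p x‖ < η := by
  obtain ⟨M, hM⟩ := hP.exists_norm_n_le hK hγ hn
  set C : ℝ := 1 + (d + 1) * (1 + |M|) * (1 + |M|) with hC
  have hC0 : 0 < C := by positivity
  obtain ⟨θ, hθ⟩ := exists_mlp_approx_on hσ hL hK (continuousOn_pair hu hp)
    (show 0 < η / C by positivity)
  refine ⟨θ, fun x hx => ?_⟩
  have hv : ‖θ.eval σ x.ofLp - pair (u x) (p x)‖ < η / C :=
    (pi_norm_lt_iff (by positivity)).2 (hθ x hx)
  rw [pTilde_eq P θ u p, add_sub_cancel_left, B_mulVec]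
  set v := θ.eval σ x.ofLp - pair (u x) (p x)
  have hN : ‖P.nTilde x‖ ≤ 1 + |M| := P.norm_nTilde_le ((hM x hx).trans (le_abs_self _))
  have hdot : ‖P.nTilde x ⬝ᵥ v‖ ≤ (d + 1) * (1 + |M|) * ‖v‖ := by
    refine (norm_sum_le _ _).trans ((Finset.sum_le_card_nsmul _ _ ((1 + |M|) * ‖v‖) ?_).trans ?_)
    · intro k _
      rw [norm_mul]
      exact mul_le_mul ((norm_le_pi_norm _ k).trans hN) (norm_le_pi_norm _ k) (norm_nonneg _)
        (by positivity)
    · simp [mul_assoc]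
  calc ‖v - (P.nTilde x ⬝ᵥ v) • P.nTilde x‖
      ≤ ‖v‖ + ‖P.nTilde x ⬝ᵥ v‖ * ‖P.nTilde x‖ := by
        rw [← norm_smul]; exact norm_sub_le _ _
    _ ≤ ‖v‖ + (d + 1) * (1 + |M|) * ‖v‖ * (1 + |M|) := by gcongr
    _ = C * ‖v‖ := by rw [hC]; ring
    _ < C * (η / C) := by gcongr
    _ = η := by field_simp

end BoundaryPiece

/-! ### The residual of the boundary part -/

/-- A continuous function that is small on the zero set of `l` is nearly a multiple of `l`: divide
it by `max l τ` for a small `τ > 0`. -/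
theorem exists_norm_smul_sub_lt {X E : Type*} [TopologicalSpace X] [NormedAddCommGroup E]
    [NormedSpace ℝ E] {K : Set X} (hK : IsCompact K) {l : X → ℝ} (hl : ContinuousOn l K)
    (hl0 : ∀ x ∈ K, 0 ≤ l x) {R : X → E} (hR : ContinuousOn R K) {η : ℝ} (hη : 0 < η)
    (hsmall : ∀ x ∈ K, l x = 0 → ‖R x‖ < η) :
    ∃ f : X → E, ContinuousOn f K ∧ ∀ x ∈ K, ‖l x • f x - R x‖ < η := by
  obtain ⟨τ, hτ, hlτ⟩ : ∃ τ > 0, ∀ x ∈ K, l x < τ → ‖R x‖ < η := by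
    by_contra! hcon
    have hg : ContinuousOn (fun x => max (l x) (η - ‖R x‖)) K := 
      ContinuousOn.sup hl (continuousOn_const.sub hR.norm)
    have hne : K.Nonempty := by
      obtain ⟨x, hx, -⟩ := hcon 1 one_pos
      exact ⟨x, hx⟩
    obtain ⟨x₀, hx₀, hmin⟩ := hK.exists_isMinOn hne hg
    have hpos : 0 < max (l x₀) (η - ‖R x₀‖) := by
      rcases (hl0 x₀ hx₀).eq_or_lt with h | h
      · exact lt_max_of_lt_right (sub_pos.2 (hsmall x₀ hx₀ h.symm))
      · exact lt_max_of_lt_left h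
    obtain ⟨x, hx, hxl, hxR⟩ := hcon _ hpos
    have h1 : max (l x₀) (η - ‖R x₀‖) ≤ max (l x) (η - ‖R x‖) := hmin hx
    exact absurd h1 (not_le.2 (max_lt hxl (lt_of_le_of_lt (sub_nonpos.2 hxR) hpos)))
  have hmax : ∀ x, 0 < max (l x) τ := fun x => lt_max_of_lt_right hτ
  refine ⟨fun x => (max (l x) τ)⁻¹ • R x,
    ((ContinuousOn.sup hl continuousOn_const).inv₀ fun x _ => (hmax x).ne').smul hR, fun x hx => ?_⟩
  have h1 : l x • (max (l x) τ)⁻¹ • R x - R x = (l x / max (l x) τ - 1) • R x := by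
    rw [sub_smul, one_smul, smul_smul, div_eq_mul_inv]
  rw [h1, norm_smul, Real.norm_eq_abs]
  rcases lt_or_ge (l x) τ with h | h
  · have h2 : |l x / max (l x) τ - 1| ≤ 1 := by
      have := div_nonneg (hl0 x hx) (hmax x).le
      have := div_le_one_of_le₀ (le_max_left (l x) τ) (hmax x).le
      rw [abs_le]; constructor <;> linarith
    exact (mul_le_of_le_one_left (norm_nonneg _) h2).trans_lt (hlτ x hx h)
  · rw [max_eq_left h, div_self (hτ.trans_le h).ne']
    simpa using hη

theorem isClosed_of_separated {X ι : Type*} [PseudoMetricSpace X] {γ : ι → Set X} {S : Set X}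
    (hS : IsClosed S) (hcover : ⋃ i, γ i = S) {δ : ℝ} (hδ : 0 < δ)
    (hsep : ∀ i i', i ≠ i' → ∀ x ∈ γ i, ∀ y ∈ γ i', δ ≤ dist x y) (i : ι) : IsClosed (γ i) := by
  refine isClosed_of_closure_subset fun x hx => ?_
  have hxS : x ∈ S := closure_minimal (hcover ▸ subset_iUnion γ i) hS hx
  rw [← hcover] at hxS
  obtain ⟨i', hi'⟩ := mem_iUnion.1 hxS
  by_contra hxi
  have hne : i' ≠ i := fun h => hxi (h ▸ hi')
  obtain ⟨y, hy, hxy⟩ := Metric.mem_closure_iff.1 hx δ hδ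
  exact absurd (hsep i' i hne x hi' y hy) (not_le.2 hxy)

/-- On `γ i` the weight of the `i`-th piece is `1`, and all others are at most `exp (-β_s)`. So for
large `β_s` the weighted sum nearly agrees on `∂Ω` with the common boundary value `p` of its
terms. -/
theorem eventually_norm_sub_sum_lt {ι E : Type*} [Fintype ι] [NormedAddCommGroup E]
    [NormedSpace ℝ E] {Ω : Set (Pt d)} {bc : ι → BoundaryPiece d} {δ : ℝ}
    (hδ : 0 < δ) (hcover : ⋃ i, (bc i).γ = frontier Ω)
    (hsep : ∀ i i', i ≠ i' → ∀ x ∈ (bc i).γ, ∀ y ∈ (bc i').γ, δ ≤ dist x y)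
    (hl : ∀ i, IsExtendedDistance Ω (bc i).γ (bc i).l)
    (hlmin : ∀ i, ∃ C > 0, ∀ x ∈ frontier Ω \ (bc i).γ, C ≤ (bc i).l x)
    {p : Pt d → E} {q : ι → Pt d → E} (hq : ∀ i, ∃ Q, ∀ x ∈ closure Ω, ‖q i x‖ ≤ Q)
    (hqp : ∀ i, ∀ x ∈ (bc i).γ, q i x = p x) {η : ℝ} (hη : 0 < η) :
    ∀ᶠ βs in atTop, ∀ x ∈ frontier Ω,
      ‖p x - ∑ i, Real.exp (-((bc i).alpha Ω βs) * (bc i).l x) • q i x‖ < η := by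
  classical
  choose Q hQ using hq
  have hlim : Tendsto (fun βs => Real.exp (-βs) * ∑ i, |Q i|) atTop (𝓝 0) := by
    simpa using (Real.tendsto_exp_neg_atTop_nhds_zero).mul_const (∑ i, |Q i|)
  filter_upwards [hlim.eventually_lt_const hη, eventually_ge_atTop 0] with βs hβ hβ0 x hx
  have hxc : x ∈ closure Ω := frontier_subset_closure hx
  obtain ⟨i, hi⟩ := mem_iUnion.1 (hcover ▸ hx)
  have hbound : ∀ i' ∈ Finset.univ.erase i,
      ‖Real.exp (-((bc i').alpha Ω βs) * (bc i').l x) • q i' x‖ ≤ Real.exp (-βs) * |Q i'| := by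
    intro i' hi'
    have hxi' : x ∉ (bc i').γ := fun h => by
      have := hsep i i' (Finset.ne_of_mem_erase hi').symm x hi x h
      rw [dist_self] at this
      linarith
    obtain ⟨C, hC, hCl⟩ := hlmin i'
    have hbdd : BddBelow ((bc i').l '' (frontier Ω \ (bc i').γ)) :=
      ⟨C, by rintro _ ⟨y, hy, rfl⟩; exact hCl y hy⟩
    have hmem : (bc i').l x ∈ (bc i').l '' (frontier Ω \ (bc i').γ) :=
      mem_image_of_mem _ ⟨hx, hxi'⟩
    have hinf0 : 0 < sInf ((bc i').l '' (frontier Ω \ (bc i').γ)) :=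
      hC.trans_le (le_csInf ⟨_, hmem⟩ (by rintro _ ⟨y, hy, rfl⟩; exact hCl y hy))
    have hinf : sInf ((bc i').l '' (frontier Ω \ (bc i').γ)) ≤ (bc i').l x := csInf_le hbdd hmem
    have hα : βs ≤ (bc i').alpha Ω βs * (bc i').l x := by
      rw [BoundaryPiece.alpha, div_mul_eq_mul_div, le_div_iff₀ hinf0]
      exact mul_le_mul_of_nonneg_left hinf hβ0
    rw [norm_smul, Real.norm_eq_abs, Real.abs_exp]
    refine mul_le_mul (Real.exp_le_exp.2 ?_) ((hQ i' x hxc).trans (le_abs_self _))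
      (norm_nonneg _) (Real.exp_pos _).le
    linarith
  rw [← Finset.add_sum_erase _ _ (Finset.mem_univ i), (hl i).eq_zero x hxc hi, hqp i x hi,
    mul_zero, Real.exp_zero, one_smul, sub_add_cancel_left, norm_neg]
  refine ((norm_sum_le _ _).trans (Finset.sum_le_sum hbound)).trans_lt (lt_of_le_of_lt ?_ hβ)
  rw [← Finset.mul_sum]
  exact mul_le_mul_of_nonneg_left
    (Finset.sum_le_sum_of_subset_of_nonneg (Finset.erase_subset _ _) fun _ _ _ => abs_nonneg _)
    (Real.exp_pos _).le

theorem BoundaryPiece.alpha_nonneg {P : BoundaryPiece d} {Ω : Set (Pt d)}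
    (hl : IsExtendedDistance Ω P.γ P.l) {βs : ℝ} (hβ : 0 ≤ βs) : 0 ≤ P.alpha Ω βs := by
  refine div_nonneg hβ (Real.sInf_nonneg ?_)
  rintro _ ⟨x, ⟨hx, hxγ⟩, rfl⟩
  exact (hl.pos x (frontier_subset_closure hx) hxγ).le

theorem IsExtendedDistance.nonneg {Ω S : Set (Pt d)} {l : Pt d → ℝ}
    (hl : IsExtendedDistance Ω S l) {x : Pt d} (hx : x ∈ closure Ω) : 0 ≤ l x := by
  by_cases h : x ∈ S
  · exact (hl.eq_zero x hx h).ge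
  · exact (hl.pos x hx h).le

end HardConstraint

theorem mainTheorem3 {d n N : ℕ}
    -- the bounded domain
    (Ω : Set (Pt d)) (hΩ_open : IsOpen Ω) (hΩ_bdd : Bornology.IsBounded Ω)
    -- the boundary conditions of the `n` unknowns
    (m : Fin n → ℕ) (bc : ∀ j, Fin (m j) → BoundaryPiece d)
    (h_cover : ∀ j, ⋃ i, (bc j i).γ = frontier Ω)
    (h_sep : ∀ j, ∃ δ > 0, ∀ i i', i ≠ i' →
      ∀ x ∈ (bc j i).γ, ∀ y ∈ (bc j i').γ, δ ≤ dist x y)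
    (h_unit : ∀ j i, ∀ x ∈ (bc j i).γ, ‖(bc j i).n x‖ = 1)
    (h_ext : ∀ j i, (bc j i).IsExtended Ω)
    (h_diag : ∀ j i, (bc j i).PiecewiseDiagonalizable)
    -- the extended distance functions
    (lΩ : Pt d → ℝ) (h_lΩ : IsExtendedDistance Ω (frontier Ω) lΩ)
    (h_l : ∀ j i, IsExtendedDistance Ω (bc j i).γ (bc j i).l)
    (h_lmin : ∀ j i, ∃ C > 0, ∀ x ∈ frontier Ω \ (bc j i).γ, C ≤ (bc j i).l x)
    -- the equations and their unique, bounded, `C¹` solution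
    (F : (Fin n → Pt d → ℝ) → Fin N → Pt d → ℝ)
    (u : Fin n → Pt d → ℝ) (Du : Fin n → Pt d → Pt d)
    (hu : IsSolution Ω F bc u Du)
    (hu_bdd : ∀ j, ∃ M, ∀ x ∈ closure Ω, |u j x| ≤ M)
    (hu_unique : ∀ v Dv, IsSolution Ω F bc v Dv → ∀ j, Set.EqOn (v j) (u j) (closure Ω))
    -- the activation function and the numbers of hidden layers of the networks
    (σ : ℝ → ℝ) (hσ : IsSigmoidal σ)
    (L₀ : ℕ) (hL₀ : 1 ≤ L₀) (L : ∀ j, Fin (m j) → ℕ) (hL : ∀ j i, 1 ≤ L j i) :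
    ∀ ε > 0, ∃ (βs : ℝ) (θmain : MLP (Fin n × Fin (d + 1)) L₀ d)
      (θ : ∀ j i, MLP (Fin (d + 1)) (L j i) d),
      ∀ x ∈ Ω ∪ frontier Ω, ∀ j,
        ∑ k, |ansatz Ω lΩ bc σ βs θmain θ j x k - pair (u j x) (Du j x) k| < ε := by
  intro ε hε
  have hK : IsCompact (closure Ω) := hΩ_bdd.isCompact_closure
  choose δ hδ hsep using h_sep
  have hγ : ∀ j i, IsClosed (bc j i).γ := fun j =>
    isClosed_of_separated isClosed_frontier (h_cover j) (hδ j) (hsep j)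
  have hγK : ∀ j i, (bc j i).γ ⊆ closure Ω := fun j i =>
    (h_cover j ▸ subset_iUnion (fun i => (bc j i).γ) i : (bc j i).γ ⊆ frontier Ω).trans
      frontier_subset_closure
  have hn : ∀ j i, ∀ y ∈ (bc j i).γ, ‖(bc j i).n y‖ ≤ 1 := fun j i y hy => (h_unit j i y hy).le
  set p : Fin n → Pt d → Fin (d + 1) → ℝ := fun j x => pair (u j x) (Du j x) with hp
  have hpc : ∀ j, ContinuousOn (p j) (closure Ω) := fun j =>
    continuousOn_pair (hu.c1 j).cont (hu.c1 j).grad_cont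
  set q : ∀ j, Fin (m j) → Pt d → Fin (d + 1) → ℝ := fun j i =>
    (bc j i).exactSolution (u j) (Du j) with hq
  have hqc : ∀ j i, ContinuousOn (q j i) (closure Ω) := fun j i =>
    (h_ext j i).continuousOn_exactSolution hK (hγ j i) (hγK j i) (hn j i) (hu.c1 j).cont
      (hu.c1 j).grad_cont (hu.boundary j i)
  -- the three sources of error: the residual, the main network, the boundary networks
  set η : ℝ := ε / (3 * (d + 1)) with hη
  have hη0 : 0 < η := by positivity
  obtain ⟨βs, hβ, hβ0⟩ := ((eventually_all.2 fun j => eventually_norm_sub_sum_lt (hδ j)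
    (h_cover j) (hsep j) (h_l j) (h_lmin j)
    (fun i => hK.exists_bound_of_continuousOn (hqc j i))
    (fun i x hx => BoundaryPiece.exactSolution_eq_pair (hu.boundary j i x hx)) hη0).and
    (eventually_ge_atTop (0 : ℝ))).exists
  have hR : ∀ j, ContinuousOn (fun x => p j x - ∑ i, Real.exp (-((bc j i).alpha Ω βs) *
      (bc j i).l x) • q j i x) (closure Ω) := fun j =>
    (hpc j).sub (continuousOn_finsetSum _ fun i _ =>
      (Real.continuous_exp.comp_continuousOn
        (continuousOn_const.mul (h_l j i).continuousOn)).smul (hqc j i))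
  choose f hfc hf using fun j => exists_norm_smul_sub_lt hK h_lΩ.continuousOn
    (fun x hx => h_lΩ.nonneg hx) (hR j) hη0 fun x hx hx0 => hβ j x <| by
      by_contra h
      exact (h_lΩ.pos x hx h).ne' hx0
  obtain ⟨Λ, hΛ⟩ := hK.exists_bound_of_continuousOn h_lΩ.continuousOn
  have hfc' : ContinuousOn (fun x => fun jk : Fin n × Fin (d + 1) => f jk.1 x jk.2)
      (closure Ω) :=
    continuousOn_pi.2 fun jk => continuousOn_pi.1 (hfc jk.1) jk.2
  obtain ⟨θmain, hθmain⟩ := exists_mlp_approx_on hσ hL₀ hK hfc'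
    (show 0 < η / (|Λ| + 1) by positivity)
  choose θ hθ using fun j i => (h_ext j i).exists_pTilde_approx hK (hγ j i) (hn j i)
    (hu.c1 j).cont (hu.c1 j).grad_cont hσ (hL j i) (show 0 < η / (m j + 1) by positivity)
  refine ⟨βs, θmain, θ, fun x hx j => ?_⟩
  rw [← closure_eq_self_union_frontier] at hx
  have hmain : ‖lΩ x • ((fun k => θmain.eval σ x.ofLp (j, k)) - f j x)‖ ≤ η := by
    have h1 : ‖(fun k => θmain.eval σ x.ofLp (j, k)) - f j x‖ ≤ η / (|Λ| + 1) :=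
      (pi_norm_le_iff_of_nonneg (by positivity)).2 fun k => (hθmain x hx (j, k)).le
    rw [norm_smul]
    calc ‖lΩ x‖ * _ ≤ (|Λ| + 1) * (η / (|Λ| + 1)) := by
          gcongr
          exact (hΛ x hx).trans ((le_abs_self _).trans (lt_add_one _).le)
      _ = η := by field_simp
  have hbd : ‖∑ i, Real.exp (-((bc j i).alpha Ω βs) * (bc j i).l x) •
      ((bc j i).pTilde σ (θ j i) x - q j i x)‖ ≤ η := by
    refine (norm_sum_le_of_le _ (n := fun _ => η / (m j + 1)) fun i _ => ?_).trans ?_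
    · rw [norm_smul, Real.norm_eq_abs, Real.abs_exp]
      refine (mul_le_of_le_one_left (norm_nonneg _) (Real.exp_le_one_iff.2 ?_)).trans
        (hθ j i x hx).le
      have := mul_nonneg (BoundaryPiece.alpha_nonneg (h_l j i) hβ0) ((h_l j i).nonneg hx)
      linarith
    · rw [Finset.sum_const, Finset.card_univ, Fintype.card_fin, nsmul_eq_mul, ← mul_div_assoc,
        div_le_iff₀ (by positivity)]
      nlinarith
  have hsplit : ansatz Ω lΩ bc σ βs θmain θ j x - p j x =
      lΩ x • ((fun k => θmain.eval σ x.ofLp (j, k)) - f j x) +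
      (lΩ x • f j x - (p j x - ∑ i, Real.exp (-((bc j i).alpha Ω βs) * (bc j i).l x) • q j i x)) +
      ∑ i, Real.exp (-((bc j i).alpha Ω βs) * (bc j i).l x) •
        ((bc j i).pTilde σ (θ j i) x - q j i x) := by
    simp only [ansatz, smul_sub, Finset.sum_sub_distrib]
    abel
  have hnorm : ‖ansatz Ω lΩ bc σ βs θmain θ j x - p j x‖ < 3 * η := by
    rw [hsplit]
    refine norm_add₃_le.trans_lt ?_
    have := hf j x hx
    linarith
  have hk : ∀ k, |ansatz Ω lΩ bc σ βs θmain θ j x k - p j x k| < 3 * η := fun k =>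
    (norm_le_pi_norm (ansatz Ω lΩ bc σ βs θmain θ j x - p j x) k).trans_lt hnorm
  calc ∑ k, |ansatz Ω lΩ bc σ βs θmain θ j x k - p j x k|
      < ∑ _k : Fin (d + 1), 3 * η :=
        Finset.sum_lt_sum_of_nonempty Finset.univ_nonempty fun k _ => hk k
    _ = ε := by
        rw [Finset.sum_const, Finset.card_univ, Fintype.card_fin, nsmul_eq_mul, hη]
        push_cast
        field_simp
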